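/- Let $R$ be a commutative ring. For a simplicial $R$-module $A_\bullet$, let $\pi_i(A_\bullet)$ denote its $i$-th homotopy group, i.e. the $i$-th homology of its normalized (Moore) chain complex; for an integer $n \geq 0$ we say that $A_\bullet$ is $n$-connected if $\pi_i(A_\bullet) = 0$ for all $0 \leq i \leq n$. A simplicial $R$-module $B_\bullet$ is called free if each $B_k$ $(k \geq 0)$ is a free $R$-module. The componentwise tensor product $A_\bullet \otimes B_\bullet$ is the simplicial $R$-module with $(A_\bullet \otimes B_\bullet)_k = A_k \otimes_R B_k$ and face and degeneracy maps $d_i \otimes d_i$ and $s_i \otimes s_i$. Let $n, m \geq 0$ be integers, let $A_\bullet$ be an $n$-connected simplicial $R$-module and let $B_\bullet$ be an $m$-connected free simplicial $R$-module. Then $A_\bullet \otimes B_\bullet$ is $(n+m+1)$-connected. -/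

import Mathlib

open CategoryTheory MonoidalCategory Simplicial Opposite

universe u

noncomputable section

namespace SimplicialModule

variable {R : Type u} [CommRing R]

/-- The `i`-th homotopy group `π_i(A)` of a simplicial `R`-module `A` (based at `0`): the `i`-th
homology of its normalized Moore complex, whose degree-`k` term is the intersection of the kernels
of `d_1, …, d_k : A_k → A_{k-1}` and whose differential is induced by `d_0`. -/
def homotopyGroup (A : SimplicialObject (ModuleCat.{u} R)) (i : ℕ) : ModuleCat.{u} R :=
  ((AlgebraicTopology.normalizedMooreComplex (ModuleCat.{u} R)).obj A).homology i

/-- A simplicial module `A` is `n`-connected if `π_i(A) = 0` for all `i ≤ n`. -/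
def IsConnected (A : SimplicialObject (ModuleCat.{u} R)) (n : ℕ) : Prop :=
  ∀ i : ℕ, i ≤ n → Subsingleton (homotopyGroup A i)

/-- A simplicial module is free if it is a free module in every simplicial degree. -/
def IsFree (B : SimplicialObject (ModuleCat.{u} R)) : Prop :=
  ∀ k : ℕ, Module.Free R (B.obj (op ⦋k⦌))

/-- The componentwise tensor product of simplicial modules: `(A ⊗ B)_k = A_k ⊗ B_k`, and a
simplicial operator acts as the tensor product of its actions on `A` and `B`. It is the pointwise
monoidal structure on functors. -/
abbrev tensor (A B : SimplicialObject (ModuleCat.{u} R)) : SimplicialObject (ModuleCat.{u} R) :=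
  Monoidal.FunctorCategory.tensorObj A B

end SimplicialModule

end

/-! The proof deloops one factor at a time. If `π_0(X) = 0`, the based path object `path X` (the
part of the décalage over the zero vertex) maps onto `X` in every degree; call the kernel `ΩX`.
Since `path X` is contractible, the long exact sequence gives `H_{i+1}(X) ≅ H_i(ΩX)`: looping lowers
connectivity by one.

Tensoring this sequence with a second simplicial module keeps it exact in each degree under the
projectivity assumptions, and keeps the middle term contractible because simplicial homotopies
tensor index by index. Hence `X ⊗ Y` is one degree more connected than `ΩX ⊗ Y`, and likewise in the
other variable. Looping all of `B` away (`Acyclic.tensor_right`) and then all of `A`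
(`Acyclic.tensor`) adds the two connectivities, with neither Eilenberg–Zilber nor Künneth. -/

noncomputable section

namespace SimplicialModule

open Limits

/-! ### Cones in the simplex category -/

/-- The functor on the simplex category adjoining a new bottom vertex. -/
def cone : SimplexCategory ⥤ SimplexCategory where
  obj n := ⦋n.len + 1⦌
  map {n m} f := SimplexCategory.mkHom
    { toFun := Fin.cons 0 fun i => (f.toOrderHom i).succ
      monotone' := by
        intro i j h
        induction i using Fin.cases with
        | zero => simp
        | succ i =>
          induction j using Fin.cases with
          | zero => simp at h
          | succ j => simpa using f.toOrderHom.monotone (by simpa using h) }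
  map_id n := by
    ext i : 3
    induction i using Fin.cases <;> simp
  map_comp f g := by
    ext i : 3
    induction i using Fin.cases <;> rfl

/-- The base of the cone. -/
def coneBase : 𝟭 SimplexCategory ⟶ cone where
  app n := SimplexCategory.δ (n := n.len) 0
  naturality n m f := by
    ext i : 3
    exact Fin.zero_succAbove _

/-- The vertex of the cone. -/
def coneVertex : (Functor.const _).obj ⦋0⦌ ⟶ cone where
  app n := SimplexCategory.const ⦋0⦌ ⦋n.len + 1⦌ 0
  naturality n m f := by
    ext i : 3
    rfl

/-- The collapse of the cone to a point. -/
def coneCollapse : cone ⟶ (Functor.const _).obj ⦋0⦌ where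
  app n := SimplexCategory.const ⦋n.len + 1⦌ ⦋0⦌ 0
  naturality n m f := by
    ext i : 3
    rfl

/-- The maps of the contraction of the cone to its vertex. -/
def coneContraction {n : ℕ} (j : Fin (n + 1)) : (⦋n + 2⦌ : SimplexCategory) ⟶ ⦋n + 1⦌ :=
  SimplexCategory.mkHom (n := n + 2) (m := n + 1)
    -- Index 0 is the cone point, so the base vertices `0, …, j` have indices `1, …, j + 1`: these
    -- are collapsed to the cone point and the later ones move down by one. At `j = 0` the new face
    -- is the identity, at `j = n` it is constant.
    { toFun := fun (i : Fin (n + 3)) =>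
        (⟨if (i : ℕ) ≤ (j : ℕ) + 1 then 0 else (i : ℕ) - 1, by split_ifs <;> omega⟩ : Fin (n + 2))
      monotone' := by
        intro a b h
        simp only [Fin.le_def] at *
        split_ifs <;> omega }

lemma coneContraction_val {n : ℕ} (j : Fin (n + 1)) (i : Fin (n + 3)) :
    ((coneContraction j).toOrderHom i : Fin (n + 2)).val =
      if (i : ℕ) ≤ (j : ℕ) + 1 then 0 else (i : ℕ) - 1 := rfl

lemma simplex_hom_ext {n m : ℕ} {f g : (⦋n⦌ : SimplexCategory) ⟶ ⦋m⦌}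
    (h : ∀ i : Fin (n + 1), (f.toOrderHom i : Fin (m + 1)).val = (g.toOrderHom i : Fin (m + 1)).val) :
    f = g := by
  ext i : 3
  exact Fin.ext (h i)

lemma simplex_comp_val {n m k : ℕ} (f : (⦋n⦌ : SimplexCategory) ⟶ ⦋m⦌)
    (g : (⦋m⦌ : SimplexCategory) ⟶ ⦋k⦌) (i : Fin (n + 1)) :
    ((f ≫ g).toOrderHom i : Fin (k + 1)).val = (g.toOrderHom (f.toOrderHom i)).val := rfl

lemma simplex_δ_val {n : ℕ} (j : Fin (n + 2)) (i : Fin (n + 1)) :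
    ((SimplexCategory.δ j).toOrderHom i : Fin (n + 2)).val =
      if (i : ℕ) < (j : ℕ) then (i : ℕ) else (i : ℕ) + 1 := by
  change (j.succAbove i).val = _
  simp only [Fin.succAbove, Fin.lt_def]
  split_ifs <;> simp_all

lemma simplex_σ_val {n : ℕ} (j : Fin (n + 1)) (i : Fin (n + 2)) :
    ((SimplexCategory.σ j).toOrderHom i : Fin (n + 1)).val =
      if (i : ℕ) ≤ (j : ℕ) then (i : ℕ) else (i : ℕ) - 1 := by
  change (j.predAbove i).val = _
  simp only [Fin.predAbove, Fin.lt_def, Fin.val_castSucc]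
  split_ifs <;> simp <;> omega

/-- The index shift leaves `δ 0` unused by the faces of the décalage; it becomes the projection
`decProj`. -/
lemma cone_map_δ {n : ℕ} (j : Fin (n + 2)) :
    cone.map (SimplexCategory.δ j) = SimplexCategory.δ (n := n + 1) j.succ := by
  refine simplex_hom_ext (n := n + 1) (m := n + 2) fun i => ?_
  rw [simplex_δ_val]
  induction i using Fin.cases with
  | zero => exact (if_pos (by simp)).symm
  | succ i =>
    change ((SimplexCategory.δ j).toOrderHom i : Fin (n + 2)).val + 1 = _
    rw [simplex_δ_val]
    simp only [Fin.val_succ]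
    split_ifs <;> omega

lemma cone_map_σ {n : ℕ} (j : Fin (n + 1)) :
    cone.map (SimplexCategory.σ j) = SimplexCategory.σ (n := n + 1) j.succ := by
  refine simplex_hom_ext (n := n + 2) (m := n + 1) fun i => ?_
  rw [simplex_σ_val]
  induction i using Fin.cases with
  | zero => exact (if_pos (by simp)).symm
  | succ i =>
    change ((SimplexCategory.σ j).toOrderHom i : Fin (n + 1)).val + 1 = _
    rw [simplex_σ_val]
    simp only [Fin.val_succ]
    split_ifs <;> omega

/-! ### Cosimplicial identities for the contraction of the cone -/

section Contraction

variable {n : ℕ}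

lemma δ_coneContraction_zero :
    SimplexCategory.δ (n := n + 1) (Fin.succ 0) ≫ coneContraction 0 = 𝟙 _ := by
  refine simplex_hom_ext fun k => ?_
  rw [simplex_comp_val, coneContraction_val, simplex_δ_val]
  trans (k : ℕ)
  · simp only [Fin.val_succ, Fin.val_zero, zero_add]
    split_ifs <;> omega
  · rfl

lemma δ_coneContraction_last :
    SimplexCategory.δ (n := n + 1) (Fin.last (n + 1)).succ ≫ coneContraction (Fin.last n) =
      SimplexCategory.const ⦋n + 1⦌ ⦋0⦌ 0 ≫ SimplexCategory.const ⦋0⦌ ⦋n + 1⦌ 0 := by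
  refine simplex_hom_ext fun k => ?_
  rw [simplex_comp_val, coneContraction_val, simplex_δ_val]
  change _ = 0
  simp only [Fin.val_succ, Fin.val_last]
  split_ifs <;> omega

lemma δ_castSucc_coneContraction_succ (i : Fin (n + 2)) (j : Fin (n + 1)) (h : i ≤ j.castSucc) :
    SimplexCategory.δ (n := n + 2) i.castSucc.succ ≫ coneContraction j.succ =
      coneContraction j ≫ SimplexCategory.δ i.succ := by
  refine simplex_hom_ext fun k => ?_
  rw [simplex_comp_val, simplex_comp_val, coneContraction_val, simplex_δ_val, simplex_δ_val,
    coneContraction_val]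
  simp only [Fin.val_succ, Fin.val_castSucc, Fin.le_def] at *
  split_ifs <;> omega

lemma δ_coneContraction_succ (j : Fin (n + 1)) :
    SimplexCategory.δ (n := n + 2) j.castSucc.succ.succ ≫ coneContraction j.succ =
      SimplexCategory.δ (n := n + 2) j.castSucc.succ.succ ≫ coneContraction j.castSucc := by
  refine simplex_hom_ext fun k => ?_
  rw [simplex_comp_val, simplex_comp_val, coneContraction_val, simplex_δ_val,
    coneContraction_val, simplex_δ_val]
  simp only [Fin.val_succ, Fin.val_castSucc] at *
  split_ifs <;> omega

lemma δ_succ_coneContraction_castSucc (i : Fin (n + 2)) (j : Fin (n + 1)) (h : j.castSucc < i) :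
    SimplexCategory.δ (n := n + 2) i.succ.succ ≫ coneContraction j.castSucc =
      coneContraction j ≫ SimplexCategory.δ i.succ := by
  refine simplex_hom_ext fun k => ?_
  rw [simplex_comp_val, simplex_comp_val, coneContraction_val, simplex_δ_val, simplex_δ_val,
    coneContraction_val]
  simp only [Fin.val_succ, Fin.val_castSucc, Fin.lt_def] at *
  split_ifs <;> omega

lemma σ_castSucc_coneContraction (i j : Fin (n + 1)) (h : i ≤ j) :
    SimplexCategory.σ (n := n + 2) i.castSucc.succ ≫ coneContraction j =
      coneContraction j.succ ≫ SimplexCategory.σ i.succ := by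
  refine simplex_hom_ext fun k => ?_
  rw [simplex_comp_val, simplex_comp_val, coneContraction_val, simplex_σ_val, simplex_σ_val,
    coneContraction_val]
  simp only [Fin.val_succ, Fin.val_castSucc, Fin.le_def] at *
  split_ifs <;> omega

lemma σ_succ_coneContraction (i j : Fin (n + 1)) (h : j ≤ i) :
    SimplexCategory.σ (n := n + 2) i.succ.succ ≫ coneContraction j =
      coneContraction j.castSucc ≫ SimplexCategory.σ i.succ := by
  refine simplex_hom_ext fun k => ?_
  rw [simplex_comp_val, simplex_comp_val, coneContraction_val, simplex_σ_val, simplex_σ_val,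
    coneContraction_val]
  simp only [Fin.val_succ, Fin.val_castSucc, Fin.le_def] at *
  split_ifs <;> omega

end Contraction

/-! ### The décalage and its contraction to the vertices -/

section Decalage

variable {C : Type*} [Category C] (X : SimplicialObject C)

lemma map_op_comp_congr {a b b' c : SimplexCategory} {f : a ⟶ b} {g : b ⟶ c} {f' : a ⟶ b'}
    {g' : b' ⟶ c} (h : f ≫ g = f' ≫ g') :
    X.map g.op ≫ X.map f.op = X.map g'.op ≫ X.map f'.op := by
  simp only [← Functor.map_comp, ← op_comp, h]

/-- The décalage of a simplicial object. -/
def dec : SimplicialObject C := cone.op ⋙ X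

/-- The projection of the décalage onto the simplicial object. -/
def decProj : dec X ⟶ X where
  app n := X.map (coneBase.app n.unop).op
  naturality n m f := by
    exact map_op_comp_congr X (coneBase.naturality f.unop).symm

/-- The augmentation of the décalage to the constant object on the vertices. -/
def decVertex : dec X ⟶ (Functor.const _).obj (X.obj (op ⦋0⦌)) where
  app n := X.map (coneVertex.app n.unop).op
  naturality n m f := by
    exact (map_op_comp_congr X (coneVertex.naturality f.unop).symm).trans
      (congrArg (X.map _ ≫ ·) (X.map_id _))

/-- The section of the augmentation of the décalage. -/
def decSection : (Functor.const _).obj (X.obj (op ⦋0⦌)) ⟶ dec X where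
  app n := X.map (coneCollapse.app n.unop).op
  naturality n m f := by
    exact (congrArg (· ≫ X.map _) (X.map_id _).symm).trans
      (map_op_comp_congr X (coneCollapse.naturality f.unop).symm)

lemma decSection_decVertex : decSection X ≫ decVertex X = 𝟙 _ := by
  ext n
  change X.map _ ≫ X.map _ = 𝟙 (X.obj _)
  rw [← Functor.map_comp, ← op_comp, ← X.map_id, ← op_id]
  congr 2
  ext i : 3
  exact Subsingleton.elim (α := Fin 1) _ _

/-- The décalage contracts to its vertices. -/
def decHomotopy : SimplicialObject.Homotopy (decVertex X ≫ decSection X) (𝟙 (dec X)) where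
  h j := X.map (coneContraction j).op
  h_zero_comp_δ_zero n := by
    have h : X.map (coneContraction (0 : Fin (n + 1))).op ≫
        X.map (SimplexCategory.δ (Fin.succ 0)).op = 𝟙 _ := by
      rw [← Functor.map_comp, ← op_comp, δ_coneContraction_zero, op_id, X.map_id]
    exact (congrArg (fun t => X.map (coneContraction 0).op ≫ X.map t.op) (cone_map_δ 0)).trans h
  h_last_comp_δ_last n :=
    map_op_comp_congr X (f := cone.map (SimplexCategory.δ _))
      (by rw [cone_map_δ]; exact δ_coneContraction_last)
  h_succ_comp_δ_castSucc_of_lt i j h :=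
    map_op_comp_congr X (f := cone.map (SimplexCategory.δ _))
      (g' := cone.map (SimplexCategory.δ _))
      (by rw [cone_map_δ, cone_map_δ]; exact δ_castSucc_coneContraction_succ i j h)
  h_succ_comp_δ_castSucc_succ j :=
    map_op_comp_congr X (f := cone.map (SimplexCategory.δ _)) (f' := cone.map (SimplexCategory.δ _))
      (by rw [cone_map_δ]; exact δ_coneContraction_succ j)
  h_castSucc_comp_δ_succ_of_lt i j h :=
    map_op_comp_congr X (f := cone.map (SimplexCategory.δ _))
      (g' := cone.map (SimplexCategory.δ _))
      (by rw [cone_map_δ, cone_map_δ]; exact δ_succ_coneContraction_castSucc i j h)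
  h_comp_σ_castSucc_of_le i j h :=
    map_op_comp_congr X (f := cone.map (SimplexCategory.σ _))
      (g' := cone.map (SimplexCategory.σ _))
      (by rw [cone_map_σ, cone_map_σ]; exact σ_castSucc_coneContraction i j h)
  h_comp_σ_succ_of_lt i j h :=
    map_op_comp_congr X (f := cone.map (SimplexCategory.σ _))
      (g' := cone.map (SimplexCategory.σ _))
      (by rw [cone_map_σ, cone_map_σ]; exact σ_succ_coneContraction i j h)

end Decalage

/-! ### Tensor products of simplicial homotopies -/

section TensorHomotopy

variable {C : Type*} [Category C] [MonoidalCategory C]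

/-- The tensor product of simplicial homotopies. -/
def tensorHomotopy {X X' Y Y' : SimplicialObject C} {f g : X ⟶ X'} {f' g' : Y ⟶ Y'}
    (H : SimplicialObject.Homotopy f g) (H' : SimplicialObject.Homotopy f' g') :
    SimplicialObject.Homotopy (X := Monoidal.FunctorCategory.tensorObj X Y)
      (Y := Monoidal.FunctorCategory.tensorObj X' Y')
      (Monoidal.FunctorCategory.tensorHom f f') (Monoidal.FunctorCategory.tensorHom g g') where
  -- Each homotopy identity involves single composites and no sums, so it holds for tensors factor
  -- by factor; no shuffles are needed.
  h j := H.h j ⊗ₘ H'.h j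
  h_zero_comp_δ_zero n := by
    change _ ≫ (X'.δ 0 ⊗ₘ Y'.δ 0) = _ ⊗ₘ _
    erw [MonoidalCategory.tensorHom_comp_tensorHom]
    simp
  h_last_comp_δ_last n := by
    change _ ≫ (X'.δ _ ⊗ₘ Y'.δ _) = _ ⊗ₘ _
    erw [MonoidalCategory.tensorHom_comp_tensorHom]
    simp
  h_succ_comp_δ_castSucc_of_lt i j hij := by
    change _ ≫ (X'.δ _ ⊗ₘ Y'.δ _) = (X.δ _ ⊗ₘ Y.δ _) ≫ _
    erw [MonoidalCategory.tensorHom_comp_tensorHom, MonoidalCategory.tensorHom_comp_tensorHom]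
    simp [hij]
  h_succ_comp_δ_castSucc_succ j := by
    change _ ≫ (X'.δ _ ⊗ₘ Y'.δ _) = _ ≫ (X'.δ _ ⊗ₘ Y'.δ _)
    erw [MonoidalCategory.tensorHom_comp_tensorHom, MonoidalCategory.tensorHom_comp_tensorHom]
    rw [H.h_succ_comp_δ_castSucc_succ, H'.h_succ_comp_δ_castSucc_succ]
  h_castSucc_comp_δ_succ_of_lt i j hij := by
    change _ ≫ (X'.δ _ ⊗ₘ Y'.δ _) = (X.δ _ ⊗ₘ Y.δ _) ≫ _
    erw [MonoidalCategory.tensorHom_comp_tensorHom, MonoidalCategory.tensorHom_comp_tensorHom]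
    simp [hij]
  h_comp_σ_castSucc_of_le i j hij := by
    change _ ≫ (X'.σ _ ⊗ₘ Y'.σ _) = (X.σ _ ⊗ₘ Y.σ _) ≫ _
    erw [MonoidalCategory.tensorHom_comp_tensorHom, MonoidalCategory.tensorHom_comp_tensorHom]
    simp [hij]
  h_comp_σ_succ_of_lt i j hij := by
    change _ ≫ (X'.σ _ ⊗ₘ Y'.σ _) = (X.σ _ ⊗ₘ Y.σ _) ≫ _
    erw [MonoidalCategory.tensorHom_comp_tensorHom, MonoidalCategory.tensorHom_comp_tensorHom]
    simp [hij]

end TensorHomotopy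

/-! ### Acyclicity and the long exact sequence -/

variable {R : Type u} [CommRing R]

/-- The homology of the alternating face map complex vanishes in degrees below `N`. -/
def Acyclic (X : SimplicialObject (ModuleCat.{u} R)) (N : ℕ) : Prop :=
  ∀ i < N, IsZero (((AlgebraicTopology.alternatingFaceMapComplex (ModuleCat.{u} R)).obj X).homology i)

/-- The normalized and alternating complexes are homotopy equivalent. The strict bound makes `N = 0`
an empty condition, from which the inductions start. -/
lemma isConnected_iff (X : SimplicialObject (ModuleCat.{u} R)) (n : ℕ) :
    IsConnected X n ↔ Acyclic X (n + 1) := by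
  refine forall_congr' fun i => ?_
  rw [Nat.lt_succ_iff, ← ModuleCat.isZero_iff_subsingleton]
  refine imp_congr_right fun _ => ?_
  exact ((AlgebraicTopology.DoldKan.homotopyEquivNormalizedMooreComplexAlternatingFaceMapComplex
      (Y := X)).toHomologyIso i).isZero_iff

lemma isZero_homology_of_homotopy {X : SimplicialObject (ModuleCat.{u} R)}
    (H : SimplicialObject.Homotopy (0 : X ⟶ X) (𝟙 X)) (i : ℕ) :
    IsZero (((AlgebraicTopology.alternatingFaceMapComplex (ModuleCat.{u} R)).obj X).homology i) := by
  rw [IsZero.iff_id_eq_zero]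
  have h := (H.map_homology_eq i).symm
  simp only [CategoryTheory.Functor.map_id, Functor.map_zero] at h
  exact h

lemma isZero_homology_zero_iff (X : SimplicialObject (ModuleCat.{u} R)) :
    IsZero (((AlgebraicTopology.alternatingFaceMapComplex (ModuleCat.{u} R)).obj X).homology 0) ↔
      Epi (X.δ (0 : Fin 2) - X.δ 1) := by
  rw [← HomologicalComplex.exactAt_iff_isZero_homology,
    HomologicalComplex.exactAt_iff' _ 1 0 0 (by simp) (by simp)]
  rw [ShortComplex.exact_iff_epi _ (by simp; rfl)]
  simp [Fin.sum_univ_two, sub_eq_add_neg]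
  rfl

section LongExactSequence

variable (S : ShortComplex (SimplicialObject (ModuleCat.{u} R)))
  (hS : ∀ k : ℕ, (S.map ((evaluation _ _).obj (op ⦋k⦌))).ShortExact)

include hS

lemma shortExact_alternatingFaceMapComplex :
    (S.map (AlgebraicTopology.alternatingFaceMapComplex (ModuleCat.{u} R))).ShortExact :=
  HomologicalComplex.shortExact_of_degreewise_shortExact _ hS

/-- With a contractible middle term, the connecting map `H_{i+1}(X₃) → H_i(X₁)` is an isomorphism.
-/
lemma acyclic_kernel_of_homotopy (H : SimplicialObject.Homotopy (0 : S.X₂ ⟶ S.X₂) (𝟙 S.X₂)) {N : ℕ}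
    (h : Acyclic S.X₃ (N + 1)) : Acyclic S.X₁ N := fun i hi =>
  (h (i + 1) (by omega)).of_iso
    ((shortExact_alternatingFaceMapComplex S hS).δIso (i + 1) i rfl
      (isZero_homology_of_homotopy H _) (isZero_homology_of_homotopy H _)).symm

lemma acyclic_cokernel_of_homotopy (H : SimplicialObject.Homotopy (0 : S.X₂ ⟶ S.X₂) (𝟙 S.X₂))
    {N : ℕ} (h : Acyclic S.X₁ N) : Acyclic S.X₃ (N + 1) := by
  rintro (_ | i) hi
  -- Degree 0 is not the source of a connecting map; instead `H_0(X₃)` is a quotient of `H_0(X₂) =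
  -- 0`.
  · have h₂ := (isZero_homology_zero_iff _).1 (isZero_homology_of_homotopy H 0)
    have h₃ : Epi (S.g.app (op ⦋0⦌)) := (hS 0).epi_g
    rw [isZero_homology_zero_iff]
    have : S.g.app (op ⦋1⦌) ≫ (S.X₃.δ (0 : Fin 2) - S.X₃.δ 1) =
        (S.X₂.δ (0 : Fin 2) - S.X₂.δ 1) ≫ S.g.app (op ⦋0⦌) := by
      simp [Preadditive.comp_sub, Preadditive.sub_comp]
    have h₄ := epi_comp (S.X₂.δ (0 : Fin 2) - S.X₂.δ 1) (S.g.app (op ⦋0⦌))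
    rw [← this] at h₄
    exact epi_of_epi (S.g.app (op ⦋1⦌)) _
  · exact (h i (by omega)).of_iso
      ((shortExact_alternatingFaceMapComplex S hS).δIso (i + 1) i rfl
        (isZero_homology_of_homotopy H _) (isZero_homology_of_homotopy H _))

end LongExactSequence

/-! ### The path object -/

section PathObject

variable {C : Type*} [Category C] [Abelian C] (X : SimplicialObject C)

/-- The based path object: the part of the décalage over the zero vertex. -/
def path : SimplicialObject C := kernel (decVertex X)

/-- The inclusion of the path object in the décalage. -/
def pathInclusion : path X ⟶ dec X := kernel.ι (decVertex X)

/-- The retraction of the décalage onto the path object. -/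
def pathRetraction : dec X ⟶ path X :=
  kernel.lift (decVertex X) (𝟙 _ - decVertex X ≫ decSection X) (by
    simp [Preadditive.sub_comp, decSection_decVertex])

lemma pathRetraction_pathInclusion :
    pathRetraction X ≫ pathInclusion X = 𝟙 _ - decVertex X ≫ decSection X :=
  kernel.lift_ι _ _ _

lemma pathInclusion_decVertex : pathInclusion X ≫ decVertex X = 0 :=
  kernel.condition _

lemma pathInclusion_pathRetraction : pathInclusion X ≫ pathRetraction X = 𝟙 (path X) := by
  have : Mono (pathInclusion X) := inferInstanceAs (Mono (kernel.ι (decVertex X)))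
  rw [← cancel_mono (pathInclusion X), Category.assoc, pathRetraction_pathInclusion,
    Preadditive.comp_sub, ← Category.assoc, pathInclusion_decVertex]
  simp

/-- The path object is contractible. -/
def pathHomotopy : SimplicialObject.Homotopy (0 : path X ⟶ path X) (𝟙 _) := by
  -- `path X` is a retract of `dec X`, and the end of the homotopy that factors through the vertices
  -- dies on it.
  have H := ((decHomotopy X).precomp (pathInclusion X)).postcomp (pathRetraction X)
  rwa [← Category.assoc, pathInclusion_decVertex, zero_comp, zero_comp, Category.comp_id,
    pathInclusion_pathRetraction] at H

/-- The path fibration, with the loop object as its kernel. -/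
def pathSequence : ShortComplex (SimplicialObject C) :=
  ShortComplex.mk (kernel.ι (pathInclusion X ≫ decProj X)) (pathInclusion X ≫ decProj X)
    (kernel.condition _)

end PathObject

/-! ### Exactness of the path sequence and projectivity of its terms -/

lemma map_op_map_op_apply (X : SimplicialObject (ModuleCat.{u} R)) {a b c : SimplexCategory}
    (f : a ⟶ b) (g : b ⟶ c) (x : X.obj (op c)) :
    X.map f.op (X.map g.op x) = X.map (f ≫ g).op x := by
  simp

/-- The degenerate simplex `s_0 x` lifts `x`, but its initial vertex `v` need not be zero. As
`π_0(X) = 0`, an edge joins `v` to `0`; subtracting a degeneration of it kills `v` without changing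
`d_0`. -/
lemma exists_path_lift (X : SimplicialObject (ModuleCat.{u} R)) (h : Acyclic X 1) (k : ℕ)
    (x : X.obj (op ⦋k⦌)) :
    ∃ y : X.obj (op ⦋k + 1⦌), X.map (SimplexCategory.δ (0 : Fin (k + 2))).op y = x ∧
      X.map (SimplexCategory.const ⦋0⦌ ⦋k + 1⦌ 0).op y = 0 := by
  have h₀ := (isZero_homology_zero_iff X).1 (h 0 zero_lt_one)
  rw [ModuleCat.epi_iff_surjective] at h₀
  let y₀ := X.map (SimplexCategory.σ (0 : Fin (k + 1))).op x
  have hy₀ : X.map (SimplexCategory.δ (0 : Fin (k + 2))).op y₀ = x := by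
    rw [map_op_map_op_apply]
    have := SimplexCategory.δ_comp_σ_self (i := (0 : Fin (k + 1)))
    rw [Fin.castSucc_zero] at this
    simp [this]
  obtain ⟨w, hw⟩ := h₀ (X.map (SimplexCategory.const ⦋0⦌ ⦋k + 1⦌ 0).op y₀)
  -- Along `c` an edge becomes a `(k + 1)`-simplex with the same initial vertex, whose 0-th face is
  -- degenerate on the end vertex.
  let c : (⦋k + 1⦌ : SimplexCategory) ⟶ ⦋1⦌ := SimplexCategory.mkHom
    { toFun := fun i : Fin (k + 2) => if i = 0 then (0 : Fin 2) else 1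
      monotone' := by
        intro a b hab
        by_cases hb : b = 0
        · subst hb
          simp [Fin.le_zero_iff.1 hab]
        · simp only [hb, if_false]
          exact Fin.le_last _ }
  have hc₀ : SimplexCategory.δ (0 : Fin (k + 2)) ≫ c =
      SimplexCategory.const ⦋k⦌ ⦋0⦌ 0 ≫ SimplexCategory.δ (0 : Fin 2) := by
    refine simplex_hom_ext fun i => ?_
    exact congrArg Fin.val (if_neg (t := (0 : Fin 2)) (e := 1) (Fin.succAbove_ne 0 i))
  have hc₁ : SimplexCategory.const ⦋0⦌ ⦋k + 1⦌ 0 ≫ c = SimplexCategory.δ (1 : Fin 2) := by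
    refine simplex_hom_ext fun i => ?_
    obtain rfl : i = 0 := Subsingleton.elim (α := Fin 1) _ _
    rfl
  -- Since `d_0 w - d_1 w = v`, the edge `s_0 d_0 w - w` has `d_0 = 0` and `d_1 = v`.
  let w' : X.obj (op ⦋1⦌) := X.map (SimplexCategory.σ (0 : Fin 1)).op
    (X.map (SimplexCategory.δ (0 : Fin 2)).op w) - w
  have hs₀ : SimplexCategory.δ (0 : Fin 2) ≫ SimplexCategory.σ (0 : Fin 1) = 𝟙 _ :=
    SimplexCategory.δ_comp_σ_self (i := (0 : Fin 1))
  have hs₁ : SimplexCategory.δ (1 : Fin 2) ≫ SimplexCategory.σ (0 : Fin 1) = 𝟙 _ :=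
    SimplexCategory.δ_comp_σ_succ (i := (0 : Fin 1))
  have hw₀ : X.map (SimplexCategory.δ (0 : Fin 2)).op w' = 0 := by
    rw [map_sub, map_op_map_op_apply, hs₀]
    simp
  have hw₁ : X.map (SimplexCategory.δ (1 : Fin 2)).op w' =
      X.map (SimplexCategory.const ⦋0⦌ ⦋k + 1⦌ 0).op y₀ := by
    rw [map_sub, map_op_map_op_apply, hs₁, ← hw]
    simp
    rfl
  refine ⟨y₀ - X.map c.op w', ?_, ?_⟩
  · rw [map_sub, hy₀, map_op_map_op_apply, hc₀, ← map_op_map_op_apply, hw₀, map_zero, sub_zero]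
  · rw [map_sub, ← hw₁, map_op_map_op_apply, hc₁, sub_self]

lemma pathSequence_epi (X : SimplicialObject (ModuleCat.{u} R)) (h : Acyclic X 1) (k : ℕ) :
    Epi ((pathSequence X).g.app (op ⦋k⦌)) := by
  -- Preimages may be sought in `dec X`: there the composite is `d_0` minus a term that depends only
  -- on the initial vertex, which is zero for the lift.
  suffices Epi ((pathRetraction X).app (op ⦋k⦌) ≫ (pathSequence X).g.app (op ⦋k⦌)) from
    epi_of_epi ((pathRetraction X).app (op ⦋k⦌)) _
  have e : (pathRetraction X).app (op ⦋k⦌) ≫ (pathSequence X).g.app (op ⦋k⦌) =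
      (decProj X - decVertex X ≫ decSection X ≫ decProj X).app (op ⦋k⦌) := by
    change (pathRetraction X ≫ pathInclusion X ≫ decProj X).app _ = _
    rw [← Category.assoc, pathRetraction_pathInclusion, Preadditive.sub_comp]
    simp
  rw [e]
  refine (ModuleCat.epi_iff_surjective _).2 ?_
  intro (x : X.obj (op ⦋k⦌))
  obtain ⟨y, hy, hy'⟩ := exists_path_lift X h k x
  refine ⟨(y : (dec X).obj (op ⦋k⦌)), ?_⟩
  change X.map (SimplexCategory.δ (0 : Fin (k + 2))).op y -
    (decProj X).app (op ⦋k⦌) ((decSection X).app (op ⦋k⦌)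
      (X.map (SimplexCategory.const ⦋0⦌ ⦋k + 1⦌ 0).op y)) = x
  rw [hy, hy']
  erw [map_zero, map_zero, sub_zero]

lemma pathSequence_shortExact (X : SimplicialObject (ModuleCat.{u} R)) (h : Acyclic X 1) (k : ℕ) :
    ((pathSequence X).map ((evaluation _ _).obj (op ⦋k⦌))).ShortExact := by
  have h₁ : (pathSequence X).Exact :=
    ShortComplex.exact_of_f_is_kernel _ (kernelIsKernel _)
  have : Mono (pathSequence X).f := equalizer.ι_mono
  exact
    { exact := h₁.map _
      mono_f := inferInstanceAs (Mono (((evaluation _ _).obj (op ⦋k⦌)).map (pathSequence X).f))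
      epi_g := pathSequence_epi X h k }

lemma projective_path (X : SimplicialObject (ModuleCat.{u} R))
    (h : ∀ k : ℕ, Projective (X.obj (op ⦋k⦌))) (k : ℕ) :
    Projective ((path X).obj (op ⦋k⦌)) := by
  have : Projective ((dec X).obj (op ⦋k⦌)) := h (k + 1)
  exact (Retract.mk ((pathInclusion X).app (op ⦋k⦌)) ((pathRetraction X).app (op ⦋k⦌))
    (congrArg (fun f => f.app (op ⦋k⦌)) (pathInclusion_pathRetraction X))).projective

/-- The sequence splits in each degree, so loops are a retract of paths. Projectivity thus passes to
loops, which is why it replaces freeness in the induction. -/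
lemma projective_loop (X : SimplicialObject (ModuleCat.{u} R)) (h₁ : Acyclic X 1)
    (h : ∀ k : ℕ, Projective (X.obj (op ⦋k⦌))) (k : ℕ) :
    Projective ((pathSequence X).X₁.obj (op ⦋k⦌)) := by
  have hS := pathSequence_shortExact X h₁ k
  have : Projective ((pathSequence X).map ((evaluation _ _).obj (op ⦋k⦌))).X₃ := h k
  have : Projective ((pathSequence X).map ((evaluation _ _).obj (op ⦋k⦌))).X₂ :=
    projective_path X h k
  have s := hS.splittingOfProjective
  exact (Retract.mk _ s.r s.f_r).projective

/-! ### Tensoring the path sequence -/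

/-- Tensoring a short complex of simplicial modules with a simplicial module on the right. -/
def tensorRightSequence (S : ShortComplex (SimplicialObject (ModuleCat.{u} R)))
    (Y : SimplicialObject (ModuleCat.{u} R)) : ShortComplex (SimplicialObject (ModuleCat.{u} R)) where
  X₁ := tensor S.X₁ Y
  X₂ := tensor S.X₂ Y
  X₃ := tensor S.X₃ Y
  f := Monoidal.FunctorCategory.tensorHom S.f (𝟙 Y)
  g := Monoidal.FunctorCategory.tensorHom S.g (𝟙 Y)
  zero := by
    refine NatTrans.ext (funext fun n => ?_)
    have : S.f.app n ≫ S.g.app n = 0 := congrArg (fun f => f.app n) S.zero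
    change (S.f.app n ⊗ₘ 𝟙 _) ≫ (S.g.app n ⊗ₘ 𝟙 _) = 0
    rw [MonoidalCategory.tensorHom_comp_tensorHom, this]
    simp

/-- Tensoring a short complex of simplicial modules with a simplicial module on the left. -/
def tensorLeftSequence (Y : SimplicialObject (ModuleCat.{u} R))
    (S : ShortComplex (SimplicialObject (ModuleCat.{u} R))) :
    ShortComplex (SimplicialObject (ModuleCat.{u} R)) where
  X₁ := tensor Y S.X₁
  X₂ := tensor Y S.X₂
  X₃ := tensor Y S.X₃
  f := Monoidal.FunctorCategory.tensorHom (𝟙 Y) S.f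
  g := Monoidal.FunctorCategory.tensorHom (𝟙 Y) S.g
  zero := by
    refine NatTrans.ext (funext fun n => ?_)
    have : S.f.app n ≫ S.g.app n = 0 := congrArg (fun f => f.app n) S.zero
    change (𝟙 _ ⊗ₘ S.f.app n) ≫ (𝟙 _ ⊗ₘ S.g.app n) = 0
    rw [MonoidalCategory.tensorHom_comp_tensorHom, this]
    simp

/-- Tensoring a contraction on the right. -/
def contractionTensorRight {X : SimplicialObject (ModuleCat.{u} R)}
    (H : SimplicialObject.Homotopy (0 : X ⟶ X) (𝟙 X)) (Y : SimplicialObject (ModuleCat.{u} R)) :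
    SimplicialObject.Homotopy (0 : tensor X Y ⟶ tensor X Y) (𝟙 _) := by
  have H' := tensorHomotopy H (.refl (𝟙 Y))
  have h₀ : Monoidal.FunctorCategory.tensorHom (0 : X ⟶ X) (𝟙 Y) = 0 := by
    refine NatTrans.ext (funext fun n => ?_)
    change (0 : X.obj n ⟶ X.obj n) ⊗ₘ 𝟙 _ = 0
    simp
  have h₁ : Monoidal.FunctorCategory.tensorHom (𝟙 X) (𝟙 Y) = 𝟙 _ := by
    refine NatTrans.ext (funext fun n => ?_)
    exact MonoidalCategory.id_tensorHom_id _ _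
  rwa [h₀, h₁] at H'

/-- Tensoring a contraction on the left. -/
def contractionTensorLeft (Y : SimplicialObject (ModuleCat.{u} R))
    {X : SimplicialObject (ModuleCat.{u} R)}
    (H : SimplicialObject.Homotopy (0 : X ⟶ X) (𝟙 X)) :
    SimplicialObject.Homotopy (0 : tensor Y X ⟶ tensor Y X) (𝟙 _) := by
  have H' := tensorHomotopy (.refl (𝟙 Y)) H
  have h₀ : Monoidal.FunctorCategory.tensorHom (𝟙 Y) (0 : X ⟶ X) = 0 := by
    refine NatTrans.ext (funext fun n => ?_)
    change 𝟙 _ ⊗ₘ (0 : X.obj n ⟶ X.obj n) = 0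
    simp
  have h₁ : Monoidal.FunctorCategory.tensorHom (𝟙 Y) (𝟙 X) = 𝟙 _ := by
    refine NatTrans.ext (funext fun n => ?_)
    exact MonoidalCategory.id_tensorHom_id _ _
  rwa [h₀, h₁] at H'

lemma shortExact_tensorRight {S : ShortComplex (ModuleCat.{u} R)} (hS : S.ShortExact)
    (M : ModuleCat.{u} R) [Module.Flat R M] : (S.map (tensorRight M)).ShortExact where
  exact := Module.Flat.rTensor_shortComplex_exact M S hS.exact
  mono_f := by
    have := hS.mono_f
    rw [ModuleCat.mono_iff_injective] at this ⊢
    exact Module.Flat.rTensor_preserves_injective_linearMap S.f.hom this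
  epi_g := by
    have := hS.epi_g
    rw [ModuleCat.epi_iff_surjective] at this ⊢
    exact LinearMap.rTensor_surjective M this

lemma tensorRightSequence_shortExact (S : ShortComplex (SimplicialObject (ModuleCat.{u} R)))
    (hS : ∀ k : ℕ, (S.map ((evaluation _ _).obj (op ⦋k⦌))).ShortExact)
    (Y : SimplicialObject (ModuleCat.{u} R)) (hY : ∀ k : ℕ, Projective (Y.obj (op ⦋k⦌))) (k : ℕ) :
    ((tensorRightSequence S Y).map ((evaluation _ _).obj (op ⦋k⦌))).ShortExact := by
  have := (IsProjective.iff_projective (R := R) _).2 (hY k)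
  have h := shortExact_tensorRight (hS k) (Y.obj (op ⦋k⦌))
  refine ShortComplex.shortExact_of_iso
    (ShortComplex.isoMk (Iso.refl _) (Iso.refl _) (Iso.refl _) ?_ ?_) h
  · exact (Category.id_comp _).trans ((MonoidalCategory.tensorHom_id _ _).trans (Category.comp_id _).symm)
  · exact (Category.id_comp _).trans ((MonoidalCategory.tensorHom_id _ _).trans (Category.comp_id _).symm)

/-- `Y` need not be flat: a projective quotient splits the sequence in each degree, and any additive
functor preserves a splitting. -/
lemma tensorLeftSequence_shortExact (S : ShortComplex (SimplicialObject (ModuleCat.{u} R)))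
    (hS : ∀ k : ℕ, (S.map ((evaluation _ _).obj (op ⦋k⦌))).ShortExact)
    (Y : SimplicialObject (ModuleCat.{u} R)) (hY : ∀ k : ℕ, Projective (S.X₃.obj (op ⦋k⦌))) (k : ℕ) :
    ((tensorLeftSequence Y S).map ((evaluation _ _).obj (op ⦋k⦌))).ShortExact := by
  have : Projective (S.map ((evaluation _ _).obj (op ⦋k⦌))).X₃ := hY k
  have h := ((hS k).splittingOfProjective.map (tensorLeft (Y.obj (op ⦋k⦌)))).shortExact
  refine ShortComplex.shortExact_of_iso
    (ShortComplex.isoMk (Iso.refl _) (Iso.refl _) (Iso.refl _) ?_ ?_) h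
  · exact (Category.id_comp _).trans ((MonoidalCategory.id_tensorHom _ _).trans (Category.comp_id _).symm)
  · exact (Category.id_comp _).trans ((MonoidalCategory.id_tensorHom _ _).trans (Category.comp_id _).symm)

/-! ### Induction on connectivity -/

lemma Acyclic.tensor_right {b : ℕ} (X Y : SimplicialObject (ModuleCat.{u} R)) (hY : Acyclic Y b)
    (hp : ∀ k : ℕ, Projective (Y.obj (op ⦋k⦌))) : Acyclic (tensor X Y) b := by
  induction b generalizing Y with
  | zero => exact fun i hi => absurd hi (Nat.not_lt_zero i)
  | succ b ih =>
    have h₁ : Acyclic Y 1 := fun i hi => hY i (by omega)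
    have hS := pathSequence_shortExact Y h₁
    -- `X ⊗ ΩY` is acyclic below `b` by induction, and delooping gains one degree.
    exact acyclic_cokernel_of_homotopy _ (tensorLeftSequence_shortExact _ hS X hp)
      (contractionTensorLeft X (pathHomotopy Y))
      (ih _ (acyclic_kernel_of_homotopy _ hS (pathHomotopy Y) hY) (projective_loop Y h₁ hp))

/-- Now `X` is looped and `Y` stays fixed. Flatness of `Y` gives exactness, so nothing is asked of
`ΩX` beyond acyclicity; the base case is `Acyclic.tensor_right`. -/
lemma Acyclic.tensor {a b : ℕ} (X Y : SimplicialObject (ModuleCat.{u} R)) (hX : Acyclic X a)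
    (hY : Acyclic Y b) (hp : ∀ k : ℕ, Projective (Y.obj (op ⦋k⦌))) :
    Acyclic (tensor X Y) (b + a) := by
  induction a generalizing X with
  | zero => exact hY.tensor_right X Y hp
  | succ a ih =>
    have h₁ : Acyclic X 1 := fun i hi => hX i (by omega)
    have hS := pathSequence_shortExact X h₁
    exact acyclic_cokernel_of_homotopy _ (tensorRightSequence_shortExact _ hS Y hp)
      (contractionTensorRight (pathHomotopy X) Y)
      (ih _ (acyclic_kernel_of_homotopy _ hS (pathHomotopy X) hX))

end SimplicialModule

end

theorem mainTheorem5 {R : Type u} [CommRing R]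
    (A B : SimplicialObject (ModuleCat.{u} R)) (n m : ℕ)
    (hA : SimplicialModule.IsConnected A n)
    (hB : SimplicialModule.IsConnected B m)
    (hfree : SimplicialModule.IsFree B) :
    SimplicialModule.IsConnected (SimplicialModule.tensor A B) (n + m + 1) := by
  rw [SimplicialModule.isConnected_iff] at hA hB ⊢
  have h := hA.tensor A B hB fun k => by
    have := hfree k
    exact (IsProjective.iff_projective (R := R) (B.obj (op ⦋k⦌))).1 inferInstance
  -- The strict bounds are `n + 1` and `m + 1`, and their sum is `(n + m + 1) + 1`.
  convert h using 1
  omega
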